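/- **Conventions.** A $w$-bit integer is given in sign-magnitude form: one sign bit and $w$ bits for the absolute value (both representations of $0$ are allowed). A $\mathsf{TC}^0$ circuit family is a (non-uniform) family of circuits with unbounded fan-in $\mathsf{MAJORITY}$ gates and $\neg$ gates whose depth is bounded by an absolute constant and whose size is bounded by a polynomial in the stated parameters. A matrix $A'\in\mathbb{Z}^{M\times 2N}$ is a 2-commodity matrix ($A'\in\mathcal{MC}_2$) if its columns correspond to variables $x_1,\dots,x_N,y_1,\dots,y_N$ and each row is a nonzero multiple of the coefficient vector of one of $x_j-x_k$, $y_j-y_k$, $x_j-y_j-(x_k-y_k)$ with $j\ne k$. Rational vectors are given entry by entry as (not necessarily reduced) fractions with a sign-magnitude numerator and a positive binary denominator; a rational vector is $v$-bit if all numerators and denominators have $v$ bits. **Theorem.** For all integers $m,n,w\ge 1$ there are numbers $M,N,B$ with $$M=O(nmw\log(n+1)),\qquad 2N=O(nmw\log(n+1)),\qquad B=O(w\log(n+1)),$$ with absolute implied constants, such that the following holds. 1. For each $u\ge 0$ there is a $\mathsf{TC}^0$ circuit, of absolute constant depth and of size polynomial in $m,n,w,u$, which, given an $m\times n$ matrix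 $A$ with $w$-bit integer entries and a vector $b$ with $u$-bit integer entries, outputs an $M\times 2N$ matrix $A'\in\mathcal{MC}_2$ with $B$-bit integer entries and an integer vector $b'\in\mathbb{Z}^M$, such that $Ax=b$ has a real solution $x$ if and only if $A'x'=b'$ has a real solution $x'$. 2. For each $v\ge 0$ there is a $\mathsf{TC}^0$ circuit, of absolute constant depth and of size polynomial in $m,n,w,v$, and depending only on $m,n,w,v$, which, given any $v$-bit rational solution $x'$ of a system $A'x'=b'$ produced in 1 from $(A,b)$, outputs a rational vector $x$ with $Ax=b$. -/

import Mathlib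

/-- A gate of a threshold circuit reading the wires `V`: a negation, or a majority gate of
unbounded fan-in (a wire may be read several times; every reading counts towards the size). -/
inductive TCGate (V : Type) : Type
  | neg (a : V) : TCGate V
  | maj (l : List V) : TCGate V

/-- The wires read by a gate, with multiplicity. -/
def TCGate.wires {V : Type} : TCGate V → List V
  | .neg a => [a]
  | .maj l => l

/-- The value of a gate: a majority gate outputs `true` iff strictly more than half of its
inputs are `true`. -/
def TCGate.eval {V : Type} (val : V → Bool) : TCGate V → Bool
  | .neg a => !(val a)
  | .maj l => decide (l.length < 2 * l.countP val)

/-- A threshold circuit with input bits indexed by `I` and output bits indexed by `O`: a finite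
acyclic network of negation and majority gates. Acyclicity is witnessed by a labelling of the
gates with levels, where every gate only reads input bits and gates of lower level. -/
structure TCCircuit (I O : Type) where
  Gate : Type
  fintypeGate : Fintype Gate
  gate : Gate → TCGate (I ⊕ Gate)
  level : Gate → ℕ
  level_lt : ∀ g h : Gate, Sum.inr h ∈ (gate g).wires → level h < level g
  output : O → I ⊕ Gate

namespace TCCircuit

variable {I O : Type}

/-- Values of the gates on the input `x`, correct for all gates of level less than `t`. -/
def valueUpTo (K : TCCircuit I O) (x : I → Bool) : ℕ → K.Gate → Bool
  | 0, _ => false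
  | t + 1, g => (K.gate g).eval (Sum.elim x (K.valueUpTo x t))

/-- The value of a gate on the input `x`. -/
def value (K : TCCircuit I O) (x : I → Bool) (g : K.Gate) : Bool :=
  K.valueUpTo x (K.level g + 1) g

/-- The output bits of the circuit on the input `x`. -/
def eval (K : TCCircuit I O) (x : I → Bool) (o : O) : Bool :=
  Sum.elim x (K.value x) (K.output o)

/-- The number of levels of the circuit; it bounds the number of gates on every path. -/
def depth (K : TCCircuit I O) : ℕ :=
  letI := K.fintypeGate
  Finset.univ.sup fun g => K.level g + 1

/-- The size: number of gates, plus number of wires, plus number of output bits. -/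
def size [Fintype O] (K : TCCircuit I O) : ℕ :=
  letI := K.fintypeGate
  (∑ g : K.Gate, (1 + (K.gate g).wires.length)) + Fintype.card O

end TCCircuit

theorem TCGate.eval_congr {V : Type} (p q : V → Bool) (G : TCGate V)
    (h : ∀ a ∈ G.wires, p a = q a) : G.eval p = G.eval q := by
  cases G with
  | neg a => simp [TCGate.eval, h a (by simp [TCGate.wires])]
  | maj l =>
    have hc : l.countP p = l.countP q :=
      List.countP_congr fun a ha => by rw [h a ha]
    simp [TCGate.eval, hc]

theorem TCCircuit.valueUpTo_eq {I O : Type} (K : TCCircuit I O) (x : I → Bool) :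
    ∀ (t : ℕ) (g : K.Gate), K.level g < t → K.valueUpTo x t g = K.value x g := by
  have key : ∀ (t s : ℕ) (g : K.Gate), K.level g < t → K.level g < s →
      K.valueUpTo x t g = K.valueUpTo x s g := by
    intro t
    induction t with
    | zero => intro s g h; omega
    | succ t ih =>
      intro s g ht hs
      cases s with
      | zero => omega
      | succ s =>
        refine TCGate.eval_congr _ _ _ ?_
        rintro (i | h) ha
        · rfl
        · have := K.level_lt g h ha
          exact ih s h (by omega) (by omega)
  intro t g ht
  exact key t _ g ht (Nat.lt_succ_self _)

/-- Every gate computes its operation on the values of the wires it reads. -/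
theorem TCCircuit.value_eq {I O : Type} (K : TCCircuit I O) (x : I → Bool) (g : K.Gate) :
    K.value x g = (K.gate g).eval (Sum.elim x (K.value x)) := by
  refine TCGate.eval_congr _ _ _ ?_
  rintro (i | h) ha
  · rfl
  · exact K.valueUpTo_eq x _ h (K.level_lt g h ha)

/-- The natural number with binary digits `β`, where `β k` has weight `2 ^ k`. -/
def natOfBits {w : ℕ} (β : Fin w → Bool) : ℕ :=
  ∑ k : Fin w, if β k then 2 ^ (k : ℕ) else 0

/-- The integer with sign-magnitude representation `β`: `β none` is the sign bit (`true` for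
negative) and `β (some k)` are the `w` bits of the absolute value. -/
def intOfBits {w : ℕ} (β : Option (Fin w) → Bool) : ℤ :=
  (if β none then -1 else 1) * (natOfBits fun k => β (some k) : ℤ)

/-- The bit positions in the representation of a linear system with rows `R` and columns `C`,
with `w`-bit coefficients and a `u`-bit right-hand side. -/
abbrev SystemBits (R C : Type) (w u : ℕ) : Type :=
  (R × C × Option (Fin w)) ⊕ (R × Option (Fin u))

/-- `β` is a sign-magnitude representation of the integer linear system `A x = b`. -/
def EncodesSystem {R C : Type} {w u : ℕ} (β : SystemBits R C w u → Bool)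
    (A : Matrix R C ℤ) (b : R → ℤ) : Prop :=
  (∀ i j, intOfBits (fun k => β (Sum.inl (i, j, k))) = A i j) ∧
    ∀ i, intOfBits (fun k => β (Sum.inr (i, k))) = b i

/-- The bit positions in the representation of a rational vector with entries indexed by `C`:
each entry is a fraction with a signed `v`-bit numerator and a `v`-bit denominator. -/
abbrev VectorBits (C : Type) (v : ℕ) : Type :=
  C × (Option (Fin v) ⊕ Fin v)

/-- `β` represents the rational vector `x` by (not necessarily reduced) fractions, entry by
entry, with positive denominators. -/
def EncodesVector {C : Type} {v : ℕ} (β : VectorBits C v → Bool) (x : C → ℚ) : Prop :=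
  ∀ j, 0 < natOfBits (fun k => β (j, Sum.inr k)) ∧
    x j = (intOfBits (fun k => β (j, Sum.inl k)) : ℚ) / (natOfBits fun k => β (j, Sum.inr k))

/-- Two-commodity matrices: the columns are `N` variables `x_j` (`Sum.inl j`) and `N` variables
`y_j` (`Sum.inr j`), and each row is a nonzero multiple of the coefficient vector of
`x_j - x_k`, of `y_j - y_k`, or of `x_j - y_j - (x_k - y_k)`, for some `j ≠ k`. -/
def IsMC2 {R : Type} {N : ℕ} (A : Matrix R (Fin N ⊕ Fin N) ℤ) : Prop :=
  ∀ i, ∃ c : ℤ, c ≠ 0 ∧ ∃ j k : Fin N, j ≠ k ∧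
    (A i = c • (Pi.single (Sum.inl j) 1 - Pi.single (Sum.inl k) 1) ∨
      A i = c • (Pi.single (Sum.inr j) 1 - Pi.single (Sum.inr k) 1) ∨
      A i = c • (Pi.single (Sum.inl j) 1 - Pi.single (Sum.inr j) 1
        - (Pi.single (Sum.inl k) 1 - Pi.single (Sum.inr k) 1)))

/-- `x` solves the integer linear system `A x = b` over the field `F`. -/
def SolvesOver (F : Type) [Field F] {R C : Type} [Fintype C] (A : Matrix R C ℤ) (b : R → ℤ)
    (x : C → F) : Prop :=
  (A.map (fun z : ℤ => (z : F))).mulVec x = fun i => (b i : F)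

/-!
A linear system is translated into incidences of points in the plane. A two-commodity system
assigns to each index a point `(x_j, y_j)`, and its equations with right-hand side `0` say that
two points agree in `x`, in `y`, or in `x - y`. Relative to a point chosen as the origin, these
three directions suffice for addition: from points with first coordinate `a` and second coordinate
`c` one gets the point `(a, c)`, hence the point `(a - c, 0)` on the same diagonal; in particular
`(v, -v)` leads to `(2 v, 0)`. So the multiples `2 ^ k * x_j` arise by doubling, and every row
`∑ a_ij x_j` is summed up digit by digit of the coefficients (`Equation.edge`). The coefficients of
the given system only decide which of three points enters in a summation step, so every digit of
the new system depends on at most two digits of the old one (`Equation.decides_edge`), and its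
coefficients are `-1`, `0`, `1`. There are `O(n m w)` points and equations. The given equation
`∑ a_ij x_j = b_i` becomes an equation with right-hand side `b_i` between the final point of row
`i` and the origin. `Equation.realizes_coord` and `Equation.Realizes.sum_eq` say that
solutions of the two systems correspond to each other over every field.

A solution of the given system is recovered from one of the new system as the difference of the
first coordinates of `2 ^ 0 * x_j` and of the origin. These are fractions with arbitrary
denominators, so that multiplication and subtraction of integers in `TC⁰` are required. Both
reduce to iterated addition (`Decides.testBit_sum`): the binary positions are grouped into blocks
of logarithmic length `L`, threshold gates determine the sum of the summands in each block, which
is less than `2 ^ (2 L)`, and the remaining addition of two numbers in base `2 ^ L` is done by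
carry lookahead (`carry_eq_one_iff`). Absolute differences come from two's complements
(`Decides.distance`).

Circuits are built bit by bit: `Decides P d e p` says that a predicate of bit strings has a circuit
of depth at most `d` and size at most `P ^ e`, and the closure properties of this notion track
explicit constants `d` and `e`.
-/

/-! ### Composing circuits -/

/-- Renaming the wires read by a gate. -/
def TCGate.map {V W : Type} (φ : V → W) : TCGate V → TCGate W
  | .neg a => .neg (φ a)
  | .maj l => .maj (l.map φ)

theorem TCGate.wires_map {V W : Type} (φ : V → W) (G : TCGate V) :
    (G.map φ).wires = G.wires.map φ := by
  cases G <;> rfl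

theorem TCGate.length_wires_map {V W : Type} (φ : V → W) (G : TCGate V) :
    (G.map φ).wires.length = G.wires.length := by
  rw [wires_map, List.length_map]

theorem TCGate.eval_map {V W : Type} (φ : V → W) (G : TCGate V) (val : W → Bool) :
    (G.map φ).eval val = G.eval (val ∘ φ) := by
  cases G with
  | neg a => rfl
  | maj l => simp [TCGate.map, TCGate.eval, List.countP_map]

namespace TCCircuit

/-- A map of gates that is compatible with the wiring preserves the values of the gates. -/
theorem value_embed {I O O' : Type} (K : TCCircuit I O) (K' : TCCircuit I O')
    (φ : K.Gate → K'.Gate) (h : ∀ g, K'.gate (φ g) = (K.gate g).map (Sum.map id φ))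
    (x : I → Bool) (g : K.Gate) : K'.value x (φ g) = K.value x g := by
  induction hl : K.level g using Nat.strong_induction_on generalizing g with
  | _ l ih =>
    rw [value_eq, value_eq, h, TCGate.eval_map]
    refine TCGate.eval_congr _ _ _ ?_
    rintro (i | g') ha
    · rfl
    · exact ih _ (hl ▸ K.level_lt g g' ha) g' rfl

theorem level_lt_depth {I O : Type} (K : TCCircuit I O) (g : K.Gate) : K.level g < K.depth := by
  let := K.fintypeGate
  exact Nat.lt_of_succ_le
    (Finset.le_sup (f := fun g => K.level g + 1) (Finset.mem_univ g))

theorem depth_le {I O : Type} (K : TCCircuit I O) (d : ℕ) (h : ∀ g, K.level g < d) :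
    K.depth ≤ d :=
  Finset.sup_le fun g _ => h g

/-- One-output circuits on the same input bits, put side by side. -/
def parallel {I O : Type} [Fintype O] (K : O → TCCircuit I Unit) : TCCircuit I O where
  Gate := Σ o, (K o).Gate
  fintypeGate := letI := fun o => (K o).fintypeGate; inferInstance
  gate g := ((K g.1).gate g.2).map (Sum.map id (Sigma.mk g.1))
  level g := (K g.1).level g.2
  level_lt := by
    rintro ⟨o, g⟩ ⟨o', h⟩ hm
    simp only [TCGate.wires_map, List.mem_map] at hm
    obtain ⟨a, ha, hb⟩ := hm
    rcases a with i | a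
    · simp at hb
    · simp only [Sum.map_inr, Sum.inr.injEq, Sigma.mk.injEq] at hb
      obtain ⟨rfl, hb⟩ := hb
      obtain rfl := eq_of_heq hb
      exact (K o).level_lt g a ha
  output o := Sum.map id (Sigma.mk o) ((K o).output ())

theorem eval_parallel {I O : Type} [Fintype O] (K : O → TCCircuit I Unit) (x : I → Bool) (o : O) :
    (parallel K).eval x o = (K o).eval x () := by
  have h := fun g => value_embed (K o) (parallel K) (fun g => ⟨o, g⟩) (fun g => rfl) x g
  unfold eval
  rcases ho : (K o).output () with i | g
  · simp [parallel, ho]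
  · simpa [parallel, ho] using h g

theorem depth_parallel_le {I O : Type} [Fintype O] (K : O → TCCircuit I Unit) (d : ℕ)
    (h : ∀ o, (K o).depth ≤ d) : (parallel K).depth ≤ d :=
  depth_le _ _ fun g => ((K g.1).level_lt_depth g.2).trans_le (h g.1)

theorem size_parallel_le {I O : Type} [Fintype O] (K : O → TCCircuit I Unit) (s : ℕ)
    (h : ∀ o, (K o).size ≤ s) : (parallel K).size ≤ Fintype.card O * s := by
  let := fun o => (K o).fintypeGate
  let := (parallel K).fintypeGate
  have e : (parallel K).size = ∑ o, (K o).size := by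
    have h1 : ∑ g : (parallel K).Gate, (1 + ((parallel K).gate g).wires.length)
        = ∑ o, ∑ g : (K o).Gate, (1 + ((K o).gate g).wires.length) :=
      (Fintype.sum_sigma (ι := O) (α := fun o => (K o).Gate) _).trans <|
        Finset.sum_congr rfl fun o _ => Finset.sum_congr rfl fun g _ =>
          congrArg (1 + ·) (TCGate.length_wires_map _ _)
    change ∑ g : (parallel K).Gate, (1 + ((parallel K).gate g).wires.length) + Fintype.card O =
      ∑ o, (∑ g : (K o).Gate, (1 + ((K o).gate g).wires.length) + Fintype.card Unit)
    rw [h1, Finset.sum_add_distrib]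
    simp
  rw [e]
  calc ∑ o, (K o).size ≤ ∑ _o : O, s := Finset.sum_le_sum fun o _ => h o
    _ = Fintype.card O * s := by simp

/-- A circuit with one additional gate on top, which reads the outputs. -/
def addGate {I T : Type} (K : TCCircuit I T) (G : TCGate T) : TCCircuit I Unit where
  Gate := Option K.Gate
  fintypeGate := letI := K.fintypeGate; inferInstance
  gate
    | none => G.map fun t => Sum.map id some (K.output t)
    | some g => (K.gate g).map (Sum.map id some)
  level
    | none => K.depth
    | some g => K.level g
  level_lt := by
    rintro (_ | g) (_ | h) hm
    · simp only [TCGate.wires_map, List.mem_map] at hm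
      obtain ⟨t, -, ht⟩ := hm
      rcases hK : K.output t with i | g <;> simp [hK] at ht
    · exact K.level_lt_depth h
    · simp [TCGate.wires_map] at hm
    · simp only [TCGate.wires_map, List.mem_map] at hm
      obtain ⟨a, ha, hb⟩ := hm
      rcases a with i | a
      · simp at hb
      · simp only [Sum.map_inr, Sum.inr.injEq, Option.some.injEq] at hb
        exact K.level_lt g h (hb ▸ ha)
  output _ := Sum.inr none

theorem eval_addGate {I T : Type} (K : TCCircuit I T) (G : TCGate T) (x : I → Bool) :
    (K.addGate G).eval x () = G.eval (K.eval x) := by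
  have h := value_embed K (K.addGate G) some (fun g => rfl) x
  refine (value_eq (K.addGate G) x none).trans ((TCGate.eval_map _ G _).trans ?_)
  refine TCGate.eval_congr _ _ _ fun t _ => ?_
  change Sum.elim x ((K.addGate G).value x) (Sum.map id some (K.output t)) =
    Sum.elim x (K.value x) (K.output t)
  rcases K.output t with i | g
  · rfl
  · exact h g

theorem depth_addGate_le {I T : Type} (K : TCCircuit I T) (G : TCGate T) :
    (K.addGate G).depth ≤ K.depth + 1 := by
  refine depth_le _ _ ?_
  rintro (_ | g)
  · exact Nat.lt_succ_self _
  · exact (K.level_lt_depth g).trans (Nat.lt_succ_self _)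

theorem size_addGate_le {I T : Type} [Fintype T] (K : TCCircuit I T) (G : TCGate T) :
    (K.addGate G).size ≤ K.size + G.wires.length + 2 := by
  let := K.fintypeGate
  have e : (K.addGate G).size
      = (1 + G.wires.length) + ∑ g : K.Gate, (1 + (K.gate g).wires.length) + 1 := by
    unfold size
    congr 1
    refine (Fintype.sum_option _).trans ?_
    congr 1
    · exact congrArg (1 + ·) (TCGate.length_wires_map _ _)
    · exact Finset.sum_congr rfl fun g _ => congrArg (1 + ·) (TCGate.length_wires_map _ _)
  rw [e]
  unfold size
  omega

/-- The circuit without gates that outputs an input bit. -/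
def wire {I : Type} (i : I) : TCCircuit I Unit where
  Gate := Empty
  fintypeGate := inferInstance
  gate := Empty.elim
  level := Empty.elim
  level_lt g := g.elim
  output _ := Sum.inl i

end TCCircuit

/-! ### Predicates of bit strings decided by small circuits -/

/-- The predicate `p` of bit strings is decided by a threshold circuit of depth at most `d` and
size at most `P ^ e`. Here `P` plays the role of the size parameter: a family of predicates is in
`TC⁰` if `d` and `e` do not depend on the parameters, and `P` is linear in them. The constants in
the lemmas on `Decides` are not optimal. -/
def Decides {I : Type} (P d e : ℕ) (p : (I → Bool) → Prop) : Prop :=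
  ∃ K : TCCircuit I Unit, K.depth ≤ d ∧ K.size ≤ P ^ e ∧ ∀ x, K.eval x () = true ↔ p x

namespace Decides

variable {I : Type} {P d e : ℕ}

theorem mono {p : (I → Bool) → Prop} (hP : 2 ≤ P) (h : Decides P d e p) {d' e' : ℕ}
    (hd : d ≤ d') (he : e ≤ e') : Decides P d' e' p := by
  obtain ⟨K, h1, h2, h3⟩ := h
  exact ⟨K, h1.trans hd, h2.trans (Nat.pow_le_pow_right (by omega) he), h3⟩

theorem congr {p q : (I → Bool) → Prop} (h : Decides P d e p) (hpq : ∀ x, p x ↔ q x) :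
    Decides P d e q := by
  obtain ⟨K, h1, h2, h3⟩ := h
  exact ⟨K, h1, h2, fun x => (h3 x).trans (hpq x)⟩

theorem bit (hP : 2 ≤ P) (i : I) : Decides P 0 1 fun x => x i = true := by
  refine ⟨.wire i, TCCircuit.depth_le _ _ fun g => g.elim, ?_, fun x => Iff.rfl⟩
  have : (TCCircuit.wire i).size = 1 := by
    unfold TCCircuit.size
    simp only [Fintype.card_unit, Nat.add_eq_right]
    exact Finset.sum_eq_zero fun g _ => g.elim
  rw [this, pow_one]
  omega

/-- A gate reading the results of given circuits. -/
theorem exists_gate {T : Type} [Fintype T] {s : ℕ} {K : T → TCCircuit I Unit}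
    (hd : ∀ t, (K t).depth ≤ d) (hs : ∀ t, (K t).size ≤ s) (G : TCGate T) :
    ∃ K' : TCCircuit I Unit, K'.depth ≤ d + 1 ∧
      K'.size ≤ Fintype.card T * s + G.wires.length + 2 ∧
      ∀ x, K'.eval x () = G.eval fun t => (K t).eval x () := by
  refine ⟨(TCCircuit.parallel K).addGate G,
    (TCCircuit.depth_addGate_le _ _).trans ?_, (TCCircuit.size_addGate_le _ _).trans ?_, ?_⟩
  · have := TCCircuit.depth_parallel_le K d hd
    omega
  · have := TCCircuit.size_parallel_le K s hs
    omega
  · intro x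
    rw [TCCircuit.eval_addGate]
    congr 1
    funext t
    exact TCCircuit.eval_parallel K x t

theorem const_false (hP : 2 ≤ P) : Decides P 1 1 fun _ : I → Bool => False := by
  obtain ⟨K, h1, h2, h3⟩ := exists_gate (I := I) (T := Empty) (d := 0) (s := 0)
    (K := Empty.elim) (fun t => t.elim) (fun t => t.elim) (.maj [])
  refine ⟨K, h1, ?_, fun x => ?_⟩
  · simp only [Fintype.card_empty, TCGate.wires, List.length_nil] at h2
    rw [pow_one]
    omega
  · simp [h3, TCGate.eval]

theorem not {p : (I → Bool) → Prop} (hP : 2 ≤ P) (h : Decides P d e p) :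
    Decides P (d + 1) (e + 2) fun x => ¬ p x := by
  obtain ⟨K, h1, h2, h3⟩ := h
  obtain ⟨K', h1', h2', h3'⟩ := exists_gate (T := Unit) (K := fun _ => K) (fun _ => h1)
    (fun _ => h2) (.neg ())
  refine ⟨K', h1', h2'.trans ?_, fun x => ?_⟩
  · have h0 : 1 ≤ P ^ e := Nat.one_le_pow _ _ (by omega)
    have h4 : 2 * 2 ≤ P * P := Nat.mul_le_mul hP hP
    simp only [Fintype.card_unit, TCGate.wires, List.length_singleton]
    calc 1 * P ^ e + 1 + 2 ≤ P ^ e * (2 * 2) := by omega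
      _ ≤ P ^ e * (P * P) := Nat.mul_le_mul_left _ h4
      _ = P ^ (e + 2) := by ring
  · simp only [h3', ← h3, TCGate.eval, Bool.not_eq_true, Bool.not_eq_true']

theorem const (hP : 2 ≤ P) (q : Prop) : Decides P 2 3 fun _ : I → Bool => q := by
  by_cases hq : q
  · exact ((const_false hP).not hP).congr fun x => by simp [hq]
  · exact ((const_false hP).mono hP (by omega) (by omega)).congr fun x => by simp [hq]

/-- Weighted threshold gates. A majority gate compares the weighted sum with `θ` once the list of
its inputs is padded by constants. -/
theorem threshold {T : Type} [Fintype T] (hP : 2 ≤ P) {f : T → (I → Bool) → Bool} {a b : ℕ}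
    (hf : ∀ t, Decides P d e fun x => f t x = true) (hT : Fintype.card T ≤ P ^ a)
    (wt : T → ℕ) (hW : ∑ t, wt t ≤ P ^ b) {θ : ℕ} (hθ : θ ≤ P ^ b) :
    Decides P (d + 3) (a + b + e + 8) fun x => θ ≤ ∑ t, if f t x then wt t else 0 := by
  have hf' : ∀ t : T ⊕ Bool, Decides P (d + 2) (e + 3)
      fun x => Sum.elim (fun t => f t x) id t = true := by
    rintro (t | c)
    · exact (hf t).mono hP (by omega) (by omega)
    · exact (const hP (c = true)).mono hP (by omega) (by omega)
  choose K h1 h2 h3 using hf'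
  set W := ∑ t, wt t with hWdef
  -- With `W + 1` constants `true` and `2 * θ` constants `false`, a majority holds iff
  -- `2 * W + 2 * θ + 1 < 2 * (count + W + 1)`, that is, iff `θ ≤ count`.
  let l : List (T ⊕ Bool) :=
    (Finset.univ.toList.flatMap fun t => List.replicate (wt t) (Sum.inl t)) ++
      (List.replicate (W + 1) (Sum.inr true) ++ List.replicate (2 * θ) (Sum.inr false))
  have hlen : (Finset.univ.toList.flatMap fun t : T =>
      List.replicate (wt t) (Sum.inl t : T ⊕ Bool)).length = W := by
    rw [List.length_flatMap]
    simp [W]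
  obtain ⟨K', h1', h2', h3'⟩ := exists_gate h1 h2 (.maj l)
  refine ⟨K', h1', h2'.trans ?_, fun x => ?_⟩
  · simp only [TCGate.wires, l, List.length_append, List.length_replicate, hlen,
      Fintype.card_sum, Fintype.card_bool]
    have ha : 1 ≤ P ^ a := Nat.one_le_pow _ _ (by omega)
    have hb : 1 ≤ P ^ b := Nat.one_le_pow _ _ (by omega)
    have he : 1 ≤ P ^ (e + 3) := Nat.one_le_pow _ _ (by omega)
    have h5 : 2 ^ 5 ≤ P ^ 5 := Nat.pow_le_pow_left hP 5
    have hx : (Fintype.card T + 2) * P ^ (e + 3) ≤ 3 * P ^ a * P ^ (e + 3) :=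
      Nat.mul_le_mul_right _ (by omega)
    have hab : P ^ a * P ^ (e + 3) ≤ P ^ a * P ^ (e + 3) * P ^ b := Nat.le_mul_of_pos_right _ hb
    have hba : P ^ b ≤ (P ^ a * P ^ (e + 3)) * P ^ b :=
      Nat.le_mul_of_pos_left _ (Nat.mul_pos ha he)
    calc _ ≤ P ^ a * P ^ (e + 3) * P ^ b * 2 ^ 5 := by
          rw [mul_assoc] at hx
          omega
      _ ≤ P ^ a * P ^ (e + 3) * P ^ b * P ^ 5 := Nat.mul_le_mul_left _ h5
      _ = P ^ (a + b + e + 8) := by ring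
  · have hval : ∀ t, (K t).eval x () = Sum.elim (fun t => f t x) id t := fun t =>
      Bool.eq_iff_iff.mpr (h3 t x)
    have hcount : (Finset.univ.toList.flatMap fun t : T =>
        List.replicate (wt t) (Sum.inl t : T ⊕ Bool)).countP
          (Sum.elim (fun t => f t x) id) = ∑ t, if f t x then wt t else 0 := by
      rw [List.countP_flatMap]
      simp only [List.countP_replicate, Function.comp_def, Sum.elim_inl]
      exact Finset.sum_map_toList _ _
    rw [h3', funext hval]
    simp only [TCGate.eval, l, List.length_append, List.countP_append, hlen, hcount,
      List.length_replicate, List.countP_replicate, Sum.elim_inr, id, decide_eq_true_eq]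
    simp only [if_true, Bool.false_eq_true, if_false]
    omega

theorem exists_mem {T : Type} [Fintype T] (hP : 2 ≤ P) {p : T → (I → Bool) → Prop} {a : ℕ}
    (hp : ∀ t, Decides P d e (p t)) (hT : Fintype.card T ≤ P ^ a) :
    Decides P (d + 3) (a + a + e + 8) fun x => ∃ t, p t x := by
  classical
  refine (threshold hP (f := fun t x => decide (p t x)) (θ := 1)
    (fun t => (hp t).congr fun x => by simp) hT (fun _ => 1) (by simpa using hT)
    (Nat.one_le_pow _ _ (by omega))).congr fun x => ?_
  simp [Finset.one_le_card, Finset.Nonempty]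

theorem forall_mem {T : Type} [Fintype T] (hP : 2 ≤ P) {p : T → (I → Bool) → Prop} {a : ℕ}
    (hp : ∀ t, Decides P d e (p t)) (hT : Fintype.card T ≤ P ^ a) :
    Decides P (d + 5) (a + a + e + 12) fun x => ∀ t, p t x := by
  refine (((exists_mem hP (fun t => (hp t).not hP) hT).not hP).mono hP (by omega)
    (by omega)).congr fun x => ?_
  simp

theorem or {p q : (I → Bool) → Prop} (hP : 2 ≤ P) (hp : Decides P d e p) (hq : Decides P d e q) :
    Decides P (d + 3) (e + 10) fun x => p x ∨ q x := by
  have h : ∀ t : Bool, Decides P d e (if t then p else q) := by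
    rintro (_ | _) <;> simpa
  refine ((exists_mem hP (a := 1) h (by simpa using hP)).mono hP le_rfl (by omega)).congr
    fun x => ?_
  simp [or_comm]

theorem and {p q : (I → Bool) → Prop} (hP : 2 ≤ P) (hp : Decides P d e p) (hq : Decides P d e q) :
    Decides P (d + 5) (e + 14) fun x => p x ∧ q x := by
  refine (((or hP (hp.not hP) (hq.not hP)).not hP).mono hP (by omega) (by omega)).congr
    fun x => ?_
  simp

theorem ite {p q r : (I → Bool) → Prop} (hP : 2 ≤ P) (hp : Decides P d e p)
    (hq : Decides P d e q) (hr : Decides P d e r) :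
    Decides P (d + 9) (e + 26) fun x => (p x ∧ q x) ∨ (¬ p x ∧ r x) := by
  refine (or hP ((and hP hp hq).mono hP (Nat.le_add_right _ 1) (Nat.le_add_right _ 2))
    (and hP (hp.not hP) (hr.mono hP (by omega) (by omega)))).mono hP (by omega) (by omega)

/-- A predicate that reads only two input bits. -/
theorem of_two_bits (hP : 2 ≤ P) (g : Bool → Bool → Prop) (i j : I) :
    Decides P 21 60 fun x => g (x i) (x j) := by
  have h : ∀ b c : Bool, Decides P 2 3 fun _ : I → Bool => g b c := fun b c => const hP _
  have hj : Decides P 2 3 fun x : I → Bool => x j = true :=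
    (bit hP j).mono hP (by omega) (by omega)
  have hi : Decides P 11 29 fun x : I → Bool => x i = true :=
    (bit hP i).mono hP (by omega) (by omega)
  refine ((ite hP hi (ite hP hj (h true true) (h true false))
    (ite hP hj (h false true) (h false false))).mono hP (by omega) (by omega)).congr fun x => ?_
  cases x i <;> cases x j <;> simp

/-- Circuits for the single output bits combine to a circuit for all of them. -/
theorem exists_circuit {O : Type} [Fintype O] {f : O → (I → Bool) → Bool}
    (hf : ∀ o, Decides P d e fun x => f o x = true) :
    ∃ K : TCCircuit I O, K.depth ≤ d ∧ K.size ≤ Fintype.card O * P ^ e ∧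
      ∀ x o, K.eval x o = f o x := by
  choose K h1 h2 h3 using hf
  exact ⟨.parallel K, TCCircuit.depth_parallel_le K d h1, TCCircuit.size_parallel_le K _ h2,
    fun x o => (TCCircuit.eval_parallel K x o).trans (Bool.eq_iff_iff.mpr (h3 o x))⟩

end Decides

/-! ### Iterated addition -/

namespace Decides

variable {I : Type} {P d e : ℕ}

/-- If the comparisons of two polynomially bounded numbers with constants are decidable, then so
is every relation between the two numbers, by going through all pairs of values. -/
theorem lookup (hP : 2 ≤ P) {U V : (I → Bool) → ℕ} {R r : ℕ} (hR : R ≤ P ^ r)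
    (hU : ∀ θ ≤ R, Decides P d e fun x => θ ≤ U x) (hV : ∀ θ ≤ R, Decides P d e fun x => θ ≤ V x)
    (hUR : ∀ x, U x < R) (hVR : ∀ x, V x < R) (g : ℕ → ℕ → Prop) :
    Decides P (d + 19) (e + 4 * r + 52) fun x => g (U x) (V x) := by
  have heq : ∀ W : (I → Bool) → ℕ, (∀ θ ≤ R, Decides P d e fun x => θ ≤ W x) → ∀ t : Fin R,
      Decides P (d + 6) (e + 16) fun x => W x = t := fun W hW t =>
    ((and hP ((hW t t.2.le).mono hP (Nat.le_add_right _ 1) (Nat.le_add_right _ 2))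
      ((hW (t + 1) t.2).not hP)).mono hP (by omega) (by omega)).congr fun x => by omega
  have hc : Fintype.card (Fin R × Fin R) ≤ P ^ (r + r) := by
    rw [Fintype.card_prod, Fintype.card_fin, pow_add]
    exact Nat.mul_le_mul hR hR
  refine ((exists_mem hP (p := fun (t : Fin R × Fin R) x => (U x = t.1 ∧ V x = t.2) ∧ g t.1 t.2)
    (fun t => and hP (and hP (heq U hU t.1) (heq V hV t.2))
      ((const hP (g t.1 t.2)).mono hP (by omega) (by omega))) hc).mono hP
    (by omega) (by omega)).congr fun x => ?_
  constructor
  · rintro ⟨t, ⟨h1, h2⟩, h3⟩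
    rwa [h1, h2]
  · exact fun h => ⟨(⟨U x, hUR x⟩, ⟨V x, hVR x⟩), ⟨rfl, rfl⟩, h⟩

end Decides

/-- The carries in the evaluation of `∑ Z i * D ^ i` in base `D`. -/
def carry (D : ℕ) (Z : ℕ → ℕ) : ℕ → ℕ
  | 0 => 0
  | i + 1 => (Z i + carry D Z i) / D

theorem carry_le_one {D : ℕ} {Z : ℕ → ℕ} (hD : 0 < D) (hZ : ∀ i, Z i + 2 ≤ 2 * D) (i : ℕ) :
    carry D Z i ≤ 1 := by
  induction i with
  | zero => exact Nat.zero_le _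
  | succ i ih =>
    have h := hZ i
    exact Nat.lt_succ_iff.mp ((Nat.div_lt_iff_lt_mul hD).mpr (by omega))

/-- Carry lookahead: a carry arrives at position `i` iff it is generated at some earlier position
and propagated by all positions in between. -/
theorem carry_eq_one_iff {D : ℕ} {Z : ℕ → ℕ} (hD : 0 < D) (hZ : ∀ i, Z i + 2 ≤ 2 * D) (i : ℕ) :
    carry D Z i = 1 ↔
      ∃ j : Fin i, D ≤ Z j ∧ ∀ l : Fin i, ((j : ℕ) < l → D ≤ Z l + 1) := by
  induction i with
  | zero => simp [carry]
  | succ i ih =>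
    have h0 := carry_le_one hD hZ i
    have h1 := carry_le_one hD hZ (i + 1)
    have h2 : carry D Z (i + 1) = 1 ↔ D ≤ Z i + carry D Z i := by
      rw [← Nat.one_le_div_iff hD]
      change carry D Z (i + 1) = 1 ↔ 1 ≤ carry D Z (i + 1)
      omega
    rw [h2]
    constructor
    · intro h
      by_cases hc : carry D Z i = 1
      · obtain ⟨j, hj, hl⟩ := ih.mp hc
        refine ⟨j.castSucc, hj, fun l hlt => ?_⟩
        rcases Nat.lt_succ_iff_lt_or_eq.mp l.2 with hl' | hl'
        · exact hl ⟨l, hl'⟩ hlt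
        · rw [hl']
          omega
      · refine ⟨Fin.last i, ?_, fun l hlt => ?_⟩
        · simp only [Fin.val_last]
          omega
        · have := l.2
          simp only [Fin.val_last] at hlt
          omega
    · rintro ⟨j, hj, hl⟩
      rcases Nat.lt_succ_iff_lt_or_eq.mp j.2 with hj' | hj'
      · have h3 := ih.mpr ⟨⟨j, hj'⟩, hj, fun l hlt => hl l.castSucc hlt⟩
        have h4 := hl (Fin.last i) hj'
        simp only [Fin.val_last] at h4
        omega
      · rw [hj'] at hj
        omega

/-- The lowest `i` positions contribute the carry into position `i` and a remainder. -/
theorem sum_range_eq_carry {D : ℕ} (Z : ℕ → ℕ) (hD : 0 < D) (i : ℕ) :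
    ∃ r < D ^ i, ∑ j ∈ Finset.range i, Z j * D ^ j = carry D Z i * D ^ i + r := by
  induction i with
  | zero => exact ⟨0, by simp, by simp [carry]⟩
  | succ i ih =>
    obtain ⟨r, hr, h⟩ := ih
    refine ⟨(Z i + carry D Z i) % D * D ^ i + r, ?_, ?_⟩
    · have h1 : (Z i + carry D Z i) % D + 1 ≤ D := Nat.mod_lt _ hD
      calc _ < ((Z i + carry D Z i) % D + 1) * D ^ i := by
            rw [add_mul, one_mul]
            omega
        _ ≤ D * D ^ i := Nat.mul_le_mul_right _ h1
        _ = D ^ (i + 1) := by ring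
    · rw [Finset.sum_range_succ, h]
      have h2 := Nat.div_add_mod (Z i + carry D Z i) D
      have h3 : carry D Z (i + 1) = (Z i + carry D Z i) / D := rfl
      rw [h3]
      generalize (Z i + carry D Z i) / D = q at *
      generalize (Z i + carry D Z i) % D = m at *
      calc carry D Z i * D ^ i + r + Z i * D ^ i = (Z i + carry D Z i) * D ^ i + r := by ring
        _ = (D * q + m) * D ^ i + r := by rw [h2]
        _ = q * D ^ (i + 1) + (m * D ^ i + r) := by ring

/-- The base-`D` digit of `∑ Z i * D ^ i` at position `i`. -/
theorem sum_range_div_mod {D : ℕ} (Z : ℕ → ℕ) (hD : 0 < D) {i J : ℕ} (hi : i < J) :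
    (∑ j ∈ Finset.range J, Z j * D ^ j) / D ^ i % D = (Z i + carry D Z i) % D := by
  obtain ⟨r, hr, h⟩ := sum_range_eq_carry Z hD i
  obtain ⟨t, rfl⟩ : ∃ t, J = i + 1 + t := ⟨J - (i + 1), by omega⟩
  have e : ∑ j ∈ Finset.range (i + 1 + t), Z j * D ^ j =
      r + D ^ i * (Z i + carry D Z i + D * ∑ j ∈ Finset.range t, Z (i + 1 + j) * D ^ j) := by
    rw [Finset.sum_range_add, Finset.sum_range_succ, h, Finset.mul_sum, mul_add, Finset.mul_sum,
      mul_add]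
    have : ∀ j ∈ Finset.range t, Z (i + 1 + j) * D ^ (i + 1 + j)
        = D ^ i * (D * (Z (i + 1 + j) * D ^ j)) := fun j _ => by ring
    rw [Finset.sum_congr rfl this]
    ring
  rw [e, Nat.add_mul_div_left _ _ (pow_pos hD i), Nat.div_eq_of_lt hr, zero_add,
    Nat.add_mul_mod_self_left]

/-- A sum of `T i * D ^ i` is rewritten by splitting each `T i` into its lowest digit in base `D`
and the rest, which moves to the next position; for `T i < D ^ 2` the new coefficients are less than
`2 * D - 1`. Here `T'` is `T` shifted by one position. -/
theorem sum_range_split (D : ℕ) (T T' : ℕ → ℕ) (h0 : T' 0 = 0) (hs : ∀ i, T' (i + 1) = T i)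
    {J : ℕ} (hJ : T J = 0) :
    ∑ i ∈ Finset.range (J + 1), (T i % D + T' i / D) * D ^ i =
      ∑ i ∈ Finset.range J, T i * D ^ i := by
  have h1 : ∑ i ∈ Finset.range (J + 1), T' i / D * D ^ i
      = ∑ i ∈ Finset.range J, T i / D * D ^ (i + 1) := by
    rw [Finset.sum_range_succ', h0]
    simp [hs]
  simp only [add_mul]
  rw [Finset.sum_add_distrib, h1, Finset.sum_range_succ, hJ, Nat.zero_mod, zero_mul, add_zero,
    ← Finset.sum_add_distrib]
  refine Finset.sum_congr rfl fun i _ => ?_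
  conv_rhs => rw [← Nat.div_add_mod (T i) D]
  ring

namespace Decides

variable {I : Type} {P d e : ℕ}

/-- Iterated addition is in `TC⁰`: the binary digits of a sum of polynomially many powers of two
are decided in constant depth. The positions are grouped into blocks of logarithmic length; the
sum of the summands in a block is found by threshold gates, and carries between blocks are
computed by lookahead. -/
theorem testBit_sum {T : Type} [Fintype T] (hP : 2 ≤ P) {f : T → (I → Bool) → Bool} {a : ℕ}
    (hf : ∀ t, Decides P d e fun x => f t x = true) (hT : Fintype.card T ≤ P ^ a)
    (ex : T → ℕ) {k : ℕ} (hk : k ≤ P ^ a) :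
    Decides P (d + 44) (e + 15 * a + 130)
      fun x => (∑ t, if f t x then 2 ^ ex t else 0).testBit k = true := by
  obtain ⟨L, hL1, hL2⟩ : ∃ L, P ^ a < 2 ^ L ∧ 2 ^ L ≤ P ^ (a + 1) := by
    refine ⟨Nat.log 2 (P ^ a) + 1, Nat.lt_pow_succ_log_self (by omega) _, ?_⟩
    rw [pow_succ, pow_succ]
    exact Nat.mul_le_mul (Nat.pow_log_le_self 2 (pow_pos (by omega) a).ne') hP
  have hLpos : 0 < L := by
    rcases Nat.eq_zero_or_pos L with rfl | h
    · have : 0 < P ^ a := pow_pos (by omega) a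
      simp at hL1
      omega
    · exact h
  set D := 2 ^ L with hDdef
  have hD : 0 < D := by positivity
  -- `B s x` is the sum of the summands in the set `s`, each shifted to the start of its block.
  let wt : (T → Bool) → T → ℕ := fun s t => if s t then 2 ^ (ex t % L) else 0
  let B : (T → Bool) → (I → Bool) → ℕ := fun s x => ∑ t, if f t x then wt s t else 0
  have hwt : ∀ s, ∑ t, wt s t ≤ P ^ a * D := fun s =>
    calc ∑ t, wt s t ≤ ∑ _t : T, D := by
          refine Finset.sum_le_sum fun t _ => ?_
          have h1 : 2 ^ (ex t % L) ≤ D :=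
            Nat.pow_le_pow_right (by omega) (Nat.mod_lt _ hLpos).le
          simp only [wt]
          split_ifs <;> omega
      _ = Fintype.card T * D := by simp
      _ ≤ P ^ a * D := Nat.mul_le_mul_right _ hT
  have hB : ∀ s x, B s x < D * D := fun s x => by
    have h1 : B s x ≤ ∑ t, wt s t := Finset.sum_le_sum fun t _ => by split_ifs <;> omega
    exact (h1.trans (hwt s)).trans_lt (Nat.mul_lt_mul_of_pos_right hL1 hD)
  have hR : D * D ≤ P ^ (2 * a + 2) := by
    calc D * D ≤ P ^ (a + 1) * P ^ (a + 1) := Nat.mul_le_mul hL2 hL2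
      _ = P ^ (2 * a + 2) := by ring
  have hBdec : ∀ s, ∀ θ ≤ D * D, Decides P (d + 3) (e + 3 * a + 10) fun x => θ ≤ B s x :=
    fun s θ hθ => (threshold hP hf hT (wt s) ((hwt s).trans
      ((Nat.mul_le_mul_right _ hL1.le).trans hR)) (hθ.trans hR)).mono hP le_rfl (by omega)
  -- The sums of the blocks `i` and `i - 1`; the latter is `0` for `i = 0`.
  let A : ℕ → (I → Bool) → ℕ := fun i => B fun t => decide (ex t / L = i)
  let A' : ℕ → (I → Bool) → ℕ := fun i => B fun t => decide (ex t / L + 1 = i)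
  let Z : (I → Bool) → ℕ → ℕ := fun x i => A i x % D + A' i x / D
  have hZ : ∀ x i, Z x i + 2 ≤ 2 * D := fun x i => by
    have h1 := Nat.mod_lt (A i x) hD
    have h2 : A' i x / D < D := (Nat.div_lt_iff_lt_mul hD).mpr (hB _ x)
    simp only [Z]
    omega
  have hlook : ∀ i (g : ℕ → Prop), Decides P (d + 22) (e + 11 * a + 70) fun x => g (Z x i) :=
    fun i g => (lookup hP hR (hBdec _) (hBdec _) (hB _) (hB _)
      fun u v => g (u % D + v / D)).mono hP (by omega) (by omega)
  have hcarry : ∀ i ≤ P ^ a, Decides P (d + 35) (e + 15 * a + 104)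
      fun x => carry D (Z x) i = 1 := fun i hi => by
    have hc : Fintype.card (Fin i) ≤ P ^ a := by simpa using hi
    refine ((exists_mem hP (fun j : Fin i => and hP
      ((hlook j fun z => D ≤ z).mono hP (Nat.le_add_right _ 5) (Nat.le_add_right _ (2 * a + 12)))
      ((forall_mem hP (fun l : Fin i => hlook l fun z => (j : ℕ) < l → D ≤ z + 1) hc).mono hP
        le_rfl (by omega))) hc).mono hP (by omega) (by omega)).congr fun x => ?_
    exact (carry_eq_one_iff hD (hZ x) i).symm
  have hsum : ∀ x, ∃ J, k / L < J ∧
      ∑ t, (if f t x then 2 ^ ex t else 0) = ∑ i ∈ Finset.range J, Z x i * D ^ i := fun x => by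
    obtain ⟨J, hJ1, hJ2⟩ : ∃ J, k / L < J ∧ ∀ t, ex t / L < J := by
      refine ⟨k / L + ∑ t, ex t / L + 1, Nat.lt_succ_of_le (Nat.le_add_right _ _), fun t => ?_⟩
      exact Nat.lt_succ_of_le ((Finset.single_le_sum (f := fun t => ex t / L)
        (fun _ _ => Nat.zero_le _) (Finset.mem_univ t)).trans (Nat.le_add_left _ _))
    refine ⟨J + 1, by omega, ?_⟩
    have hs := sum_range_split D (fun i => A i x) (fun i => A' i x) (J := J) (by simp [A', B, wt])
      (fun i => by simp [A, A', B, wt]) (by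
        refine Finset.sum_eq_zero fun t _ => ?_
        have := (hJ2 t).ne
        simp [wt, this])
    refine Eq.trans ?_ hs.symm
    simp only [A, B, Finset.sum_mul]
    rw [Finset.sum_comm]
    refine Finset.sum_congr rfl fun t _ => ?_
    rw [Finset.sum_eq_single_of_mem (ex t / L) (Finset.mem_range.mpr (hJ2 t))]
    · simp only [wt, decide_true, if_true]
      split_ifs
      · rw [hDdef, ← pow_mul, ← pow_add, Nat.mod_add_div]
      · simp
    · intro i _ hi
      simp [wt, hi.symm]
  refine ((ite hP (hcarry (k / L) ((Nat.div_le_self _ _).trans hk))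
    ((hlook (k / L) fun z => ((z + 1) % D).testBit (k % L) = true).mono hP (by omega) (by omega))
    ((hlook (k / L) fun z => (z % D).testBit (k % L) = true).mono hP (by omega)
      (by omega))).mono hP (by omega) (by omega)).congr fun x => ?_
  obtain ⟨J, hJ, hS⟩ := hsum x
  have hdig := sum_range_div_mod (Z x) hD hJ
  have hbit : (∑ t, if f t x then 2 ^ ex t else 0).testBit k
      = ((Z x (k / L) + carry D (Z x) (k / L)) % D).testBit (k % L) := by
    rw [← hdig, ← hS, hDdef, ← pow_mul, Nat.testBit_mod_two_pow, Nat.testBit_div_two_pow,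
      Nat.mod_add_div]
    simp [Nat.mod_lt _ hLpos]
  rw [hbit]
  have h1 := carry_le_one hD (hZ x) (k / L)
  by_cases hc : carry D (Z x) (k / L) = 1
  · simp [hc]
  · have hc0 : carry D (Z x) (k / L) = 0 := by omega
    simp [hc0]

end Decides

/-! ### Multiplication, and subtraction of fractions -/

theorem natOfBits_succ {K : ℕ} (β : Fin (K + 1) → Bool) :
    natOfBits β = natOfBits (fun k => β k.castSucc) + if β (Fin.last K) then 2 ^ K else 0 :=
  Fin.sum_univ_castSucc _

theorem natOfBits_lt {K : ℕ} (β : Fin K → Bool) : natOfBits β < 2 ^ K := by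
  induction K with
  | zero => simp [natOfBits]
  | succ K ih =>
    have h := ih fun k => β k.castSucc
    rw [natOfBits_succ, pow_succ]
    split_ifs <;> omega

theorem natOfBits_testBit {K N : ℕ} (h : N < 2 ^ K) :
    (natOfBits fun k : Fin K => N.testBit k) = N := by
  have key : ∀ K : ℕ, (natOfBits fun k : Fin K => N.testBit k) = N % 2 ^ K := by
    intro K
    induction K with
    | zero => simp [natOfBits, Nat.mod_one]
    | succ K ih =>
      rw [natOfBits_succ, pow_succ, Nat.mod_mul, ← ih, ← Nat.toNat_testBit]
      simp only [Fin.val_castSucc, Fin.val_last]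
      by_cases hb : N.testBit K <;> simp [hb]
  rw [key, Nat.mod_eq_of_lt h]

theorem natOfBits_not {K : ℕ} (β : Fin K → Bool) :
    natOfBits (fun k => !β k) + natOfBits β + 1 = 2 ^ K := by
  induction K with
  | zero => simp [natOfBits]
  | succ K ih =>
    have h := ih fun k => β k.castSucc
    rw [natOfBits_succ, natOfBits_succ β, pow_succ]
    cases β (Fin.last K) <;> simp only [Bool.not_true, Bool.not_false, if_true,
      Bool.false_eq_true, if_false] <;> omega

theorem natOfBits_mul_natOfBits {K : ℕ} (β γ : Fin K → Bool) :
    natOfBits β * natOfBits γ =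
      ∑ t : Fin K × Fin K, if β t.1 && γ t.2 then 2 ^ ((t.1 : ℕ) + t.2) else 0 := by
  unfold natOfBits
  rw [Finset.sum_mul_sum, Fintype.sum_prod_type]
  refine Finset.sum_congr rfl fun i _ => Finset.sum_congr rfl fun j _ => ?_
  cases β i <;> cases γ j <;> simp [pow_add]

theorem natOfBits_mul_lt {K : ℕ} (β γ : Fin K → Bool) :
    natOfBits β * natOfBits γ < 2 ^ (2 * K) := by
  rw [two_mul, pow_add]
  exact Nat.mul_lt_mul'' (natOfBits_lt β) (natOfBits_lt γ)

namespace Decides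

variable {I : Type} {P d e : ℕ}

/-- The digits of the two's complement difference `2 ^ K + a - b`. -/
theorem testBit_complement_sum (hP : 2 ≤ P) {K r : ℕ} (hK : 2 * K + 1 ≤ P ^ r)
    {a b : (I → Bool) → ℕ} (ha : ∀ x, a x < 2 ^ K) (hb : ∀ x, b x < 2 ^ K)
    (hda : ∀ k : Fin K, Decides P d e fun x => (a x).testBit k = true)
    (hdb : ∀ k : Fin K, Decides P d e fun x => (b x).testBit k = true) {k : ℕ} (hk : k ≤ K) :
    Decides P (d + 46) (e + 15 * r + 133)
      fun x => (2 ^ K + a x - b x).testBit k = true := by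
  let f : Option (Fin K ⊕ Fin K) → (I → Bool) → Bool := fun t x =>
    match t with
    | none => true
    | some (.inl k) => (a x).testBit k
    | some (.inr k) => !(b x).testBit k
  have hf : ∀ t, Decides P (d + 2) (e + 3) fun x => f t x = true := by
    rintro (_ | k | k)
    · exact (const hP (true = true)).mono hP (by omega) (by omega)
    · exact (hda k).mono hP (by omega) (by omega)
    · refine (((hdb k).not hP).mono hP (by omega) (by omega)).congr fun x => ?_
      simp [f]
  have hc : Fintype.card (Option (Fin K ⊕ Fin K)) ≤ P ^ r := by
    simp
    omega
  refine ((testBit_sum hP hf hc (fun t => t.elim 0 (Sum.elim (fun k => k) fun k => k))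
    (k := k) (by omega)).mono hP (by omega) (by omega)).congr fun x => ?_
  have h1 := natOfBits_not fun k : Fin K => (b x).testBit k
  rw [natOfBits_testBit (hb x)] at h1
  have h2 := natOfBits_testBit (ha x)
  simp only [natOfBits] at h1 h2
  have h3 : (∑ t, if f t x then 2 ^ (t.elim 0 (Sum.elim (fun k => k) fun k => k) : ℕ) else 0)
      = 2 ^ K + a x - b x := by
    rw [Fintype.sum_option, Fintype.sum_sum_type]
    simp only [f, Option.elim_none, Option.elim_some, Sum.elim_inl, Sum.elim_inr, if_true,
      pow_zero]
    rw [h2]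
    omega
  rw [h3]

/-- Comparison and absolute difference of two numbers; one of the two truncated differences
`a - b` and `b - a` vanishes. -/
theorem distance (hP : 2 ≤ P) {K r : ℕ} (hK : 2 * K + 1 ≤ P ^ r)
    {a b : (I → Bool) → ℕ} (ha : ∀ x, a x < 2 ^ K) (hb : ∀ x, b x < 2 ^ K)
    (hda : ∀ k : Fin K, Decides P d e fun x => (a x).testBit k = true)
    (hdb : ∀ k : Fin K, Decides P d e fun x => (b x).testBit k = true) :
    (Decides P (d + 47) (e + 15 * r + 135) fun x => a x < b x) ∧
      ∀ k : Fin K, Decides P (d + 55) (e + 15 * r + 159)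
        fun x => (a x - b x + (b x - a x)).testBit k = true := by
  have hsign : ∀ x, (2 ^ K + a x - b x).testBit K = true ↔ b x ≤ a x := fun x => by
    have h1 := ha x
    have h2 := hb x
    by_cases h : b x ≤ a x
    · rw [Nat.add_sub_assoc h, Nat.testBit_two_pow_add_eq, Nat.testBit_eq_false_of_lt (by omega)]
      simpa
    · rw [Nat.testBit_eq_false_of_lt (by omega)]
      simpa using h
  have h1 := fun k hk => testBit_complement_sum hP hK ha hb hda hdb (k := k) hk
  have h2 := fun k hk => testBit_complement_sum hP hK hb ha hdb hda (k := k) hk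
  refine ⟨(((h1 K le_rfl).not hP).mono hP le_rfl (by omega)).congr fun x => ?_,
    fun k => ((ite hP (h1 K le_rfl) (h1 k k.2.le) (h2 k k.2.le)).mono hP (by omega)
      (by omega)).congr fun x => ?_⟩
  · rw [hsign, not_le]
  · rw [hsign]
    by_cases h : b x ≤ a x
    · rw [Nat.add_sub_assoc h, Nat.testBit_two_pow_add_gt k.2, Nat.sub_eq_zero_of_le h]
      simp [h]
    · rw [Nat.add_sub_assoc (le_of_not_ge h), Nat.testBit_two_pow_add_gt k.2,
        Nat.sub_eq_zero_of_le (le_of_not_ge h)]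
      simp [h]

/-- The difference of two fractions, whose bits are given at the positions `p` and `q`, is in
`TC⁰`. -/
theorem exists_fraction_sub (hP : 2 ≤ P) {v : ℕ} (hv : v ≤ P)
    (p q : Option (Fin v) ⊕ Fin v → I) :
    ∃ f : Option (Fin (2 * v + 1)) ⊕ Fin (2 * v + 1) → (I → Bool) → Bool,
      (∀ o, Decides P 140 550 fun x => f o x = true) ∧
      ∀ x, intOfBits (fun k => f (.inl k) x) =
          intOfBits (fun k => x (p (.inl k))) * natOfBits (fun k => x (q (.inr k))) -
            intOfBits (fun k => x (q (.inl k))) * natOfBits (fun k => x (p (.inr k))) ∧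
        natOfBits (fun k => f (.inr k) x) =
          natOfBits (fun k => x (p (.inr k))) * natOfBits (fun k => x (q (.inr k))) := by
  let pn : (I → Bool) → ℕ := fun x => natOfBits fun k => x (p (.inl (some k)))
  let qn : (I → Bool) → ℕ := fun x => natOfBits fun k => x (q (.inl (some k)))
  let pd : (I → Bool) → ℕ := fun x => natOfBits fun k => x (p (.inr k))
  let qd : (I → Bool) → ℕ := fun x => natOfBits fun k => x (q (.inr k))
  -- The sum of the two cross products whose signs equal the given ones.
  let S : Bool → Bool → (I → Bool) → ℕ := fun σ τ x =>
    (if x (p (.inl none)) = σ then pn x * qd x else 0) +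
      if x (q (.inl none)) = τ then qn x * pd x else 0
  have h2P : ∀ n, P ^ n * 2 ≤ P ^ (n + 1) := fun n => by
    rw [pow_succ]
    exact Nat.mul_le_mul_left _ hP
  have hvv : v * v ≤ P ^ 2 := (Nat.mul_le_mul hv hv).trans_eq (sq P).symm
  have hP1 : 2 ≤ P ^ 1 := by simpa using hP
  have hbit : ∀ i (c : Bool), Decides P 21 60 fun x : I → Bool => x i = c :=
    fun i c => of_two_bits hP (fun b _ => b = c) i i
  have hK : 2 * v + 1 ≤ P ^ 3 := by
    have := h2P 1
    have := h2P 2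
    simp only [pow_one, Nat.reduceAdd] at *
    omega
  have hK' : 2 * (2 * v + 1) + 1 ≤ P ^ 4 := by
    have := h2P 3
    have := hP1.trans (Nat.pow_le_pow_right (by omega) (by omega : 1 ≤ 2))
    have := h2P 1
    have := h2P 2
    simp only [pow_one, Nat.reduceAdd] at *
    omega
  have hSlt : ∀ σ τ x, S σ τ x < 2 ^ (2 * v + 1) := fun σ τ x => by
    have h1 : pn x * qd x < 2 ^ (2 * v) := natOfBits_mul_lt _ _
    have h2 : qn x * pd x < 2 ^ (2 * v) := natOfBits_mul_lt _ _
    have h3 : 0 < 2 ^ (2 * v) := by positivity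
    simp only [S]
    rw [pow_succ]
    split_ifs <;> omega
  have hS : ∀ σ τ, ∀ k : Fin (2 * v + 1),
      Decides P 75 263 fun x => (S σ τ x).testBit k = true := fun σ τ k => by
    let g : (Fin v × Fin v) ⊕ (Fin v × Fin v) → (I → Bool) → Bool := fun t x =>
      Sum.elim
        (fun t => (x (p (.inl none)) == σ) && (x (p (.inl (some t.1))) && x (q (.inr t.2))))
        (fun t => (x (q (.inl none)) == τ) && (x (q (.inl (some t.1))) && x (p (.inr t.2)))) t
    have hg : ∀ t, Decides P 31 88 fun x => g t x = true := by
      rintro (t | t)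
      · refine (and hP ((hbit (p (.inl none)) σ).mono hP (by omega) (by omega))
          (and hP (hbit (p (.inl (some t.1))) true) (hbit (q (.inr t.2)) true))).congr fun x => ?_
        simp [g]
      · refine (and hP ((hbit (q (.inl none)) τ).mono hP (by omega) (by omega))
          (and hP (hbit (q (.inl (some t.1))) true) (hbit (p (.inr t.2)) true))).congr fun x => ?_
        simp [g]
    have hc : Fintype.card ((Fin v × Fin v) ⊕ (Fin v × Fin v)) ≤ P ^ 3 := by
      have := h2P 2
      simp only [Fintype.card_sum, Fintype.card_prod, Fintype.card_fin, Nat.reduceAdd] at *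
      omega
    refine ((testBit_sum hP hg hc (Sum.elim (fun t => (t.1 : ℕ) + t.2) fun t => (t.1 : ℕ) + t.2)
      (k := k) (by have := k.2; omega)).mono hP (by omega) (by omega)).congr fun x => ?_
    have e : (∑ t, if g t x then
        2 ^ (Sum.elim (fun t => (t.1 : ℕ) + t.2) (fun t => (t.1 : ℕ) + t.2) t : ℕ) else 0)
        = S σ τ x := by
      simp only [S, pn, qn, pd, qd]
      rw [Fintype.sum_sum_type, natOfBits_mul_natOfBits, natOfBits_mul_natOfBits]
      congr 1
      · by_cases h : x (p (.inl none)) = σ <;> simp [g, h]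
      · by_cases h : x (q (.inl none)) = τ <;> simp [g, h]
    rw [e]
  have hQ : ∀ k : Fin (2 * v + 1),
      Decides P 140 550 fun x => (pd x * qd x).testBit k = true := fun k => by
    have hc : Fintype.card (Fin v × Fin v) ≤ P ^ 3 := by
      have := h2P 2
      simp only [Fintype.card_prod, Fintype.card_fin, Nat.reduceAdd] at *
      omega
    refine ((testBit_sum hP
      (f := fun (t : Fin v × Fin v) x => x (p (.inr t.1)) && x (q (.inr t.2)))
      (fun t => (and hP (hbit (p (.inr t.1)) true) (hbit (q (.inr t.2)) true)).congr fun x => ?_)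
      hc (fun t => (t.1 : ℕ) + t.2) (k := k) (by have := k.2; omega)).mono hP (by omega)
      (by omega)).congr fun x => ?_
    · simp
    · simp only [pd, qd]
      rw [natOfBits_mul_natOfBits]
  -- The terms of `p / p' - q / q'` with positive and with negative sign.
  have hD := distance hP hK' (hSlt false true) (hSlt true false) (hS false true) (hS true false)
  refine ⟨fun o x => match o with
    | .inl none => decide (S false true x < S true false x)
    | .inl (some k) =>
      (S false true x - S true false x + (S true false x - S false true x)).testBit k
    | .inr k => (pd x * qd x).testBit k, ?_, fun x => ⟨?_, ?_⟩⟩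
  · rintro ((_ | k) | k)
    · exact (hD.1.mono hP (by omega) (by omega)).congr fun x => by simp
    · exact (hD.2 k).mono hP (by omega) (by omega)
    · exact hQ k
  · have h1 := hSlt false true x
    have h2 := hSlt true false x
    have e1 : ∀ r : Option (Fin v) ⊕ Fin v → I, intOfBits (fun k => x (r (.inl k)))
      = (if x (r (.inl none)) then -1 else 1) * (natOfBits fun k => x (r (.inl (some k))) : ℤ) :=
      fun r => rfl
    have e2 : (S false true x : ℤ) - S true false x = intOfBits (fun k => x (p (.inl k))) * qd x -
        intOfBits (fun k => x (q (.inl k))) * pd x := by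
      rw [e1 p, e1 q]
      simp only [S, pn, qn]
      cases x (p (.inl none)) <;> cases x (q (.inl none)) <;> simp <;> ring
    rw [← e2]
    have h3 : S false true x - S true false x + (S true false x - S false true x)
        < 2 ^ (2 * v + 1) := by omega
    unfold intOfBits
    simp only
    rw [natOfBits_testBit h3]
    clear hK hK'
    simp only [decide_eq_true_eq]
    split_ifs <;> omega
  · have h1 : pd x * qd x < 2 ^ (2 * v) := natOfBits_mul_lt _ _
    exact natOfBits_testBit (by rw [pow_succ]; omega)

end Decides

/-! ### Linear systems as configurations of points -/

/-- The three kinds of equations of a two-commodity system, which say that two points of the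
plane agree in the first coordinate, in the second coordinate, or in the difference of the
two. -/
inductive Axis : Type
  | fst
  | snd
  | diff

namespace Axis

/-- The coordinate, on the given axis, of the point with coordinates `X p` and `Y p`. -/
def coord {F Pt : Type} [Sub F] (X Y : Pt → F) : Axis → Pt → F
  | fst, p => X p
  | snd, p => Y p
  | diff, p => X p - Y p

/-- The coefficient vector of the equation between the coordinates of `p` and `q`. -/
def rowVec {Pt : Type} [DecidableEq Pt] (p q : Pt) : Axis → Pt ⊕ Pt → ℤ
  | fst => Pi.single (Sum.inl p) 1 - Pi.single (Sum.inl q) 1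
  | snd => Pi.single (Sum.inr p) 1 - Pi.single (Sum.inr q) 1
  | diff => Pi.single (Sum.inl p) 1 - Pi.single (Sum.inr p) 1
      - (Pi.single (Sum.inl q) 1 - Pi.single (Sum.inr q) 1)

theorem rowVec_mem {Pt : Type} [DecidableEq Pt] (p q : Pt) (κ : Axis) (c : Pt ⊕ Pt) :
    κ.rowVec p q c = -1 ∨ κ.rowVec p q c = 0 ∨ κ.rowVec p q c = 1 := by
  cases κ <;> cases c <;> simp only [rowVec, Pi.sub_apply, Pi.single_apply, Sum.inl.injEq,
    Sum.inr.injEq, reduceCtorEq, if_false] <;> (try split_ifs) <;> decide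

theorem sum_rowVec_mul {F Pt : Type} [Field F] [Fintype Pt] [DecidableEq Pt] (p q : Pt) (κ : Axis)
    (z : Pt ⊕ Pt → F) :
    ∑ c, (κ.rowVec p q c : F) * z c =
      κ.coord (fun t => z (.inl t)) (fun t => z (.inr t)) p
        - κ.coord (fun t => z (.inl t)) (fun t => z (.inr t)) q := by
  cases κ <;> simp [rowVec, coord, Pi.single_apply, sub_mul, Finset.sum_sub_distrib]

end Axis

/-- The points of the configuration: the origin (`none`), four points for every variable `j` and
every power `2 ^ k`, and two points for every row `i` and every term `s` of the row. -/
abbrev Point (m n w : ℕ) : Type :=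
  Option ((Fin n × Fin w) × Fin 4 ⊕ (Fin m × Fin (n * w)) × Fin 2)

namespace Point

variable {m n w : ℕ}

/-- The origin of the plane. -/
abbrev origin : Point m n w := none

/-- The point `(v, 0)` with `v = 2 ^ k * x j`. -/
abbrev right (t : Fin n × Fin w) : Point m n w := some (.inl (t, 0))

/-- The point `(0, -v)` with `v = 2 ^ k * x j`. -/
abbrev down (t : Fin n × Fin w) : Point m n w := some (.inl (t, 1))

/-- The point `(v, -v)` with `v = 2 ^ k * x j`. -/
abbrev rightDown (t : Fin n × Fin w) : Point m n w := some (.inl (t, 2))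

/-- The point `(v, v)` with `v = 2 ^ k * x j`. -/
abbrev rightUp (t : Fin n × Fin w) : Point m n w := some (.inl (t, 3))

/-- The point `(a, -c)`, where `c` is the term `s` of row `i` and `a` the sum of the terms
before it. -/
abbrev step (i : Fin m) (s : Fin (n * w)) : Point m n w := some (.inr ((i, s), 0))

/-- The point `(a, 0)`, where `a` is the sum of the first `t` terms of row `i`. -/
def partialSum (i : Fin m) : ℕ → Point m n w
  | 0 => origin
  | t + 1 => if h : t < n * w then some (.inr ((i, ⟨t, h⟩), 1)) else origin

/-- The point with second coordinate `-c`, where `c` is `0`, `v` or `-v` for `v = 2 ^ k * x j`,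
according to the sign bit `σ` and the digit `β` of a coefficient. -/
def select (σ β : Bool) (t : Fin n × Fin w) : Point m n w :=
  if β then if σ then rightUp t else rightDown t else origin

end Point

/-- The equations of the configuration: eight for every variable and every power of two, four
for every term of a row, and one for every row. -/
abbrev Equation (m n w : ℕ) : Type :=
  (Fin n × Fin w) × Fin 8 ⊕ (Fin m × Fin (n * w)) × Fin 4 ⊕ Fin m

namespace Equation

variable {m n w : ℕ}

open Point Axis

/-- The axis and the two points of an equation. The coefficients of the linear system are given
by the sign bits `a i j none` and the digits `a i j (some k)`; they only enter into the choice of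
the points with the summands. -/
def edge (a : Fin m → Fin n → Option (Fin w) → Bool) :
    Equation m n w → Axis × Point m n w × Point m n w
  | .inl (t, 0) => (snd, right t, origin)
  | .inl (t, 1) => (fst, down t, origin)
  | .inl (t, 2) => (diff, down t, right t)
  | .inl (t, 3) => (fst, rightDown t, right t)
  | .inl (t, 4) => (snd, rightDown t, down t)
  | .inl (t, 5) => (fst, rightUp t, right t)
  | .inl (t, 6) => (diff, rightUp t, origin)
  -- For `k = 0` there is no doubling step, and another equation is repeated.
  | .inl (t, 7) =>
    if (t.2 : ℕ) = 0 then (snd, right t, origin)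
    else (diff, right t, rightDown (t.1, ⟨t.2 - 1, by omega⟩))
  | .inr (.inl ((i, s), 0)) => (fst, step i s, partialSum i s)
  | .inr (.inl ((i, s), 1)) =>
    let t := finProdFinEquiv.symm s
    (snd, step i s, select (a i t.1 none) (a i t.1 (some t.2)) t)
  | .inr (.inl ((i, s), 2)) => (snd, partialSum i (s + 1), origin)
  | .inr (.inl ((i, s), 3)) => (diff, partialSum i (s + 1), step i s)
  | .inr (.inr i) => (fst, partialSum i (n * w), origin)

/-- The right-hand side of an equation. -/
def rhs (b : Fin m → ℤ) : Equation m n w → ℤ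
  | .inl _ => 0
  | .inr (.inl _) => 0
  | .inr (.inr i) => b i

/-- Points with coordinates `X` and `Y` satisfy all equations. -/
def Realizes {F : Type} [Field F] (a : Fin m → Fin n → Option (Fin w) → Bool) (b : Fin m → ℤ)
    (X Y : Point m n w → F) : Prop :=
  ∀ r, (edge a r).1.coord X Y (edge a r).2.1 - (edge a r).1.coord X Y (edge a r).2.2 =
    (rhs b r : F)

theorem edge_ne (hn : 1 ≤ n) (hw : 1 ≤ w) (a : Fin m → Fin n → Option (Fin w) → Bool)
    (r : Equation m n w) : (edge a r).2.1 ≠ (edge a r).2.2 := by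
  have hnw : 0 < n * w := Nat.mul_pos hn hw
  rcases r with ⟨t, q⟩ | ⟨⟨i, s⟩, q⟩ | i
  · fin_cases q <;> simp [edge]
    split_ifs <;> simp
  · fin_cases q
    · rcases s with ⟨_ | s, hs⟩
      · simp [edge, partialSum]
      · simp only [edge, partialSum]
        split_ifs <;> simp
    · simp only [edge, select]
      split_ifs <;> simp
    · simp [edge, partialSum]
    · simp [edge, partialSum]
  · obtain ⟨k, hk⟩ : ∃ k, n * w = k + 1 := ⟨n * w - 1, by omega⟩
    simp [edge, partialSum, hk]

section Terms

variable {F : Type} [Field F] (a : Fin m → Fin n → Option (Fin w) → Bool) (x : Fin n → F)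

/-- The multiple `2 ^ k * x j` of a variable. -/
def multiple (t : Fin n × Fin w) : F := 2 ^ (t.2 : ℕ) * x t.1

/-- The contribution of a digit of a coefficient to a row of the linear system. -/
def digitTerm (i : Fin m) (t : Fin n × Fin w) : F :=
  if a i t.1 (some t.2) then
    if a i t.1 none then -multiple x t else multiple x t
  else 0

/-- The terms of a row of the linear system, in the order of their summation. -/
def term (i : Fin m) (s : ℕ) : F :=
  if h : s < n * w then digitTerm a x i (finProdFinEquiv.symm ⟨s, h⟩) else 0

theorem sum_term (i : Fin m) :
    ∑ s ∈ Finset.range (n * w), term a x i s = ∑ j, (intOfBits (a i j) : F) * x j := by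
  rw [Finset.sum_range]
  simp only [term, Fin.is_lt, dif_pos, Fin.eta]
  rw [Equiv.sum_comp finProdFinEquiv.symm (digitTerm a x i), Fintype.sum_prod_type]
  refine Finset.sum_congr rfl fun j _ => ?_
  simp only [intOfBits, natOfBits, digitTerm, multiple]
  push_cast
  rw [mul_assoc, Finset.sum_mul, Finset.mul_sum]
  refine Finset.sum_congr rfl fun k _ => ?_
  split_ifs <;> simp

/-- The first coordinates of the points of the configuration given by `x`. -/
def fstCoord : Point m n w → F
  | none => 0
  | some (.inl (t, 0)) => multiple x t
  | some (.inl (_, 1)) => 0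
  | some (.inl (t, 2)) => multiple x t
  | some (.inl (t, 3)) => multiple x t
  | some (.inr ((i, s), 0)) => ∑ l ∈ Finset.range s, term a x i l
  | some (.inr ((i, s), 1)) => ∑ l ∈ Finset.range (s + 1), term a x i l

/-- The second coordinates of the points of the configuration given by `x`. -/
def sndCoord : Point m n w → F
  | none => 0
  | some (.inl (_, 0)) => 0
  | some (.inl (t, 1)) => -multiple x t
  | some (.inl (t, 2)) => -multiple x t
  | some (.inl (t, 3)) => multiple x t
  | some (.inr ((i, s), 0)) => -term a x i s
  | some (.inr (_, 1)) => 0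

theorem fstCoord_partialSum (i : Fin m) {t : ℕ} (ht : t ≤ n * w) :
    fstCoord a x (partialSum i t) = ∑ l ∈ Finset.range t, term a x i l := by
  rcases t with _ | t
  · simp [partialSum, fstCoord]
  · have h : t < n * w := ht
    simp [partialSum, fstCoord, h]

theorem sndCoord_partialSum (i : Fin m) (t : ℕ) : sndCoord a x (partialSum i t) = 0 := by
  rcases t with _ | t
  · rfl
  · by_cases h : t < n * w <;> simp [partialSum, h, sndCoord]

/-- Every solution of the linear system gives a configuration. -/
theorem realizes_coord {b : Fin m → ℤ} (hx : ∀ i, ∑ j, (intOfBits (a i j) : F) * x j = b i) :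
    Realizes a b (fstCoord a x) (sndCoord a x) := by
  rintro (⟨t, q⟩ | ⟨⟨i, s⟩, q⟩ | i)
  · fin_cases q <;> simp [edge, coord, fstCoord, sndCoord, rhs]
    split_ifs with h
    · simp
    · obtain ⟨j, k⟩ := t
      obtain ⟨k', hk⟩ : ∃ k', (k : ℕ) = k' + 1 := ⟨k - 1, by simp only at h; omega⟩
      simp only [multiple, hk, Nat.add_sub_cancel]
      ring
  · have hs : (s : ℕ) + 1 ≤ n * w := s.2
    fin_cases q
    · simp only [edge, coord, rhs, fstCoord_partialSum a x i s.2.le]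
      simp [fstCoord]
    · simp only [edge, coord, rhs, sndCoord, select, term, s.2, dif_pos, Fin.eta, digitTerm]
      split_ifs <;> simp
    · simp only [edge, coord, rhs, sndCoord_partialSum]
      simp [sndCoord]
    · simp only [edge, coord, rhs, fstCoord_partialSum a x i hs, sndCoord_partialSum]
      simp [sndCoord, fstCoord, Finset.sum_range_succ]
  · simp only [edge, coord, rhs, fstCoord_partialSum a x i le_rfl, sum_term, hx]
    simp [fstCoord]

end Terms

/-- Every configuration gives a solution of the linear system. -/
theorem Realizes.sum_eq {F : Type} [Field F] {a : Fin m → Fin n → Option (Fin w) → Bool}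
    {b : Fin m → ℤ} {X Y : Point m n w → F} (h : Realizes a b X Y) (hw : 0 < w) (i : Fin m) :
    ∑ j, (intOfBits (a i j) : F) * (X (right (j, ⟨0, hw⟩)) - X origin) = b i := by
  set x : Fin n → F := fun j => X (right (j, ⟨0, hw⟩)) - X origin with hxdef
  -- All coordinates are determined relative to those of the origin.
  have hdown : ∀ t, Y (down t) = Y origin - (X (right t) - X origin) := fun t => by
    have h0 := h (.inl (t, 0))
    have h1 := h (.inl (t, 1))
    have h2 := h (.inl (t, 2))
    simp only [edge, coord, rhs, Int.cast_zero] at h0 h1 h2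
    linear_combination h1 - h2 + h0
  have hright : ∀ j (k : ℕ) (hk : k < w), X (right (j, ⟨k, hk⟩)) - X origin = 2 ^ k * x j := by
    intro j k
    induction k with
    | zero => intro hk; simp [hxdef]
    | succ k ih =>
      intro hk
      have h0 := h (.inl ((j, ⟨k + 1, hk⟩), 0))
      have h3 := h (.inl ((j, ⟨k, by omega⟩), 3))
      have h4 := h (.inl ((j, ⟨k, by omega⟩), 4))
      have h7 := h (.inl ((j, ⟨k + 1, hk⟩), 7))
      have ih := ih (by omega)
      have hd := hdown (j, ⟨k, by omega⟩)
      simp only [edge, Nat.add_eq_zero_iff, one_ne_zero, and_false, if_false, coord, rhs,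
        Int.cast_zero, Nat.add_sub_cancel] at h0 h3 h4 h7
      linear_combination h7 + h0 + h3 - h4 - hd + 2 * ih
  have hselect : ∀ t, Y (select (a i t.1 none) (a i t.1 (some t.2)) t)
      = Y origin - digitTerm a x i t := fun t => by
    have h3 := h (.inl (t, 3))
    have h4 := h (.inl (t, 4))
    have h5 := h (.inl (t, 5))
    have h6 := h (.inl (t, 6))
    have hr := hright t.1 t.2 t.2.2
    simp only [edge, coord, rhs, Int.cast_zero, Fin.eta, Prod.mk.eta] at h3 h4 h5 h6 hr
    unfold select digitTerm multiple
    split_ifs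
    · linear_combination h5 - h6 + hr
    · linear_combination h4 + hdown t - hr
    · simp
  have hsum : ∀ s ≤ n * w,
      X (partialSum i s) - X origin = ∑ l ∈ Finset.range s, term a x i l := by
    intro s
    induction s with
    | zero => intro _; simp [partialSum]
    | succ s ih =>
      intro hs
      have hs' : s < n * w := hs
      have h0 := h (.inr (.inl ((i, ⟨s, hs'⟩), 0)))
      have h1 := h (.inr (.inl ((i, ⟨s, hs'⟩), 1)))
      have h2 := h (.inr (.inl ((i, ⟨s, hs'⟩), 2)))
      have h3 := h (.inr (.inl ((i, ⟨s, hs'⟩), 3)))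
      simp only [edge, coord, rhs, Int.cast_zero] at h0 h1 h2 h3
      rw [hselect] at h1
      rw [Finset.sum_range_succ, ← ih hs'.le]
      simp only [term, hs', dif_pos]
      linear_combination h3 + h2 + h0 - h1
  have hlast := h (.inr (.inr i))
  simp only [edge, coord, rhs] at hlast
  rw [← hlast, hsum _ le_rfl, sum_term]

end Equation

/-! ### The circuits of the reduction -/

theorem solvesOver_iff {F : Type} [Field F] {R C : Type} [Fintype C] {A : Matrix R C ℤ}
    {b : R → ℤ} {x : C → F} : SolvesOver F A b x ↔ ∀ i, ∑ j, (A i j : F) * x j = b i :=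
  funext_iff

/-- A number among `-1`, `0`, `1` from its sign and its only digit. -/
theorem intOfBits_eq_self {z : ℤ} (hz : z = -1 ∨ z = 0 ∨ z = 1) {β : Option (Fin 1) → Bool}
    (h0 : β none = decide (z < 0)) (h1 : β (some 0) = decide (z ≠ 0)) : intOfBits β = z := by
  simp only [intOfBits, natOfBits, Fin.sum_univ_one, Fin.isValue, h0, h1]
  rcases hz with rfl | rfl | rfl <;> simp

theorem intOfBits_false (u : ℕ) : intOfBits (fun _ : Option (Fin u) => false) = 0 := by
  simp [intOfBits, natOfBits]

namespace Equation

variable {m n w : ℕ}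

open Point Axis

/-- An equation depends on at most two bits of the linear system. -/
theorem decides_edge {I : Type} {P : ℕ} (hP : 2 ≤ P)
    (ι : Fin m → Fin n → Option (Fin w) → I) (g : Axis × Point m n w × Point m n w → Prop)
    (r : Equation m n w) :
    Decides P 21 60 fun α : I → Bool => g (edge (fun i j k => α (ι i j k)) r) := by
  have hc : ∀ r, (∀ a, edge a r = edge (fun _ _ _ => false) r) →
      Decides P 21 60 fun α : I → Bool => g (edge (fun i j k => α (ι i j k)) r) := fun r hr =>
    ((Decides.const hP (g (edge (fun _ _ _ => false) r))).mono hP (by omega) (by omega)).congr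
      fun α => iff_of_eq (congrArg g (hr _).symm)
  rcases r with ⟨t, q⟩ | ⟨⟨i, s⟩, q⟩ | i
  · refine hc _ fun a => ?_
    fin_cases q <;> rfl
  · by_cases hq : q = 1
    · subst hq
      let t : Fin n × Fin w := finProdFinEquiv.symm s
      exact Decides.of_two_bits hP (fun σ β => g (snd, step i s, select σ β t))
        (ι i t.1 none) (ι i t.1 (some t.2))
    · refine hc _ fun a => ?_
      fin_cases q
      · rfl
      · exact absurd rfl hq
      · rfl
      · rfl
  · exact hc _ fun a => rfl

section System

variable {M N : ℕ} (eR : Equation m n w ≃ Fin M) (eP : Point m n w ≃ Fin N)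

/-- The coefficient matrix of the equations, with the equations and the points numbered. -/
def matrix (a : Fin m → Fin n → Option (Fin w) → Bool) : Matrix (Fin M) (Fin N ⊕ Fin N) ℤ :=
  Matrix.of fun i => (edge a (eR.symm i)).1.rowVec (eP (edge a (eR.symm i)).2.1)
    (eP (edge a (eR.symm i)).2.2)

/-- The right-hand sides of the equations, with the equations numbered. -/
def vector (b : Fin m → ℤ) : Fin M → ℤ := fun i => rhs b (eR.symm i)

theorem isMC2_matrix (hn : 1 ≤ n) (hw : 1 ≤ w) (a : Fin m → Fin n → Option (Fin w) → Bool) :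
    IsMC2 (matrix eR eP a) := by
  intro i
  refine ⟨1, one_ne_zero, eP (edge a (eR.symm i)).2.1, eP (edge a (eR.symm i)).2.2,
    fun h => edge_ne hn hw a _ (eP.injective h), ?_⟩
  change rowVec _ _ (edge a (eR.symm i)).1 = _ ∨ rowVec _ _ (edge a (eR.symm i)).1 = _ ∨
    rowVec _ _ (edge a (eR.symm i)).1 = _
  cases (edge a (eR.symm i)).1 <;> simp [rowVec]

theorem solvesOver_matrix_iff {F : Type} [Field F] {a : Fin m → Fin n → Option (Fin w) → Bool}
    {b : Fin m → ℤ} {z : Fin N ⊕ Fin N → F} :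
    SolvesOver F (matrix eR eP a) (vector eR b) z ↔
      Realizes a b (fun p => z (.inl (eP p))) (fun p => z (.inr (eP p))) := by
  rw [solvesOver_iff, Realizes, ← eR.symm.forall_congr_right]
  refine forall_congr' fun i => ?_
  simp only [matrix, vector, Matrix.of_apply, sum_rowVec_mul]
  cases (edge a (eR.symm i)).1 <;> simp [coord]

end System

/-- The digits of the new system are computed from those of the given one. -/
theorem exists_system_circuit {M N : ℕ} (eR : Equation m n w ≃ Fin M)
    (eP : Point m n w ≃ Fin N) {P : ℕ} (hP : 2 ≤ P) (u : ℕ) :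
    ∃ K : TCCircuit (SystemBits (Fin m) (Fin n) w u) (SystemBits (Fin M) (Fin N ⊕ Fin N) 1 u),
      K.depth ≤ 21 ∧
      K.size ≤ Fintype.card (SystemBits (Fin M) (Fin N ⊕ Fin N) 1 u) * P ^ 60 ∧
      ∀ (A : Matrix (Fin m) (Fin n) ℤ) (b : Fin m → ℤ)
        (α : SystemBits (Fin m) (Fin n) w u → Bool), EncodesSystem α A b →
        EncodesSystem (K.eval α) (matrix eR eP fun i j k => α (.inl (i, j, k)))
          (vector eR b) := by
  let ι : Fin m → Fin n → Option (Fin w) → SystemBits (Fin m) (Fin n) w u :=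
    fun i j k => .inl (i, j, k)
  let coeff : (SystemBits (Fin m) (Fin n) w u → Bool) → Matrix (Fin M) (Fin N ⊕ Fin N) ℤ :=
    fun α => matrix eR eP fun i j k => α (ι i j k)
  let rhsBit : Equation m n w → Option (Fin u) →
      (SystemBits (Fin m) (Fin n) w u → Bool) → Bool := fun r k α =>
    match r with
    | .inr (.inr i) => α (.inr (i, k))
    | _ => false
  let f : SystemBits (Fin M) (Fin N ⊕ Fin N) 1 u →
      (SystemBits (Fin m) (Fin n) w u → Bool) → Bool := fun o α =>
    match o with
    | .inl (i, c, none) => decide (coeff α i c < 0)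
    | .inl (i, c, some _) => decide (coeff α i c ≠ 0)
    | .inr (i, k) => rhsBit (eR.symm i) k α
  have hf : ∀ o, Decides P 21 60 fun α => f o α = true := by
    rintro (⟨i, c, _ | k⟩ | ⟨i, k⟩)
    · exact (decides_edge hP ι (fun t => t.1.rowVec (eP t.2.1) (eP t.2.2) c < 0)
        (eR.symm i)).congr fun α => decide_eq_true_iff.symm
    · exact (decides_edge hP ι (fun t => t.1.rowVec (eP t.2.1) (eP t.2.2) c ≠ 0)
        (eR.symm i)).congr fun α => decide_eq_true_iff.symm
    · change Decides P 21 60 fun α => rhsBit (eR.symm i) k α = true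
      rcases eR.symm i with r | r | i'
      · exact (Decides.const hP (false = true)).mono hP (by omega) (by omega)
      · exact (Decides.const hP (false = true)).mono hP (by omega) (by omega)
      · exact (Decides.bit hP _).mono hP (by omega) (by omega)
  obtain ⟨K, h1, h2, h3⟩ := Decides.exists_circuit hf
  refine ⟨K, h1, h2, fun A b α hα => ⟨fun i c => ?_, fun i => ?_⟩⟩
  · exact intOfBits_eq_self (rowVec_mem _ _ _ _) (h3 _ _) (h3 _ _)
  · simp only [h3]
    change intOfBits (fun k => rhsBit (eR.symm i) k α) = rhs b (eR.symm i)
    rcases eR.symm i with r | r | i'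
    · exact intOfBits_false u
    · exact intOfBits_false u
    · exact hα.2 i'

end Equation

/-- The circuit that subtracts, for every `j`, the entry `c₀` from the entry `c j` of a rational
vector. -/
theorem exists_difference_circuit {C : Type} {n P v : ℕ} (hP : 2 ≤ P) (hv : v ≤ P)
    (c : Fin n → C) (c₀ : C) :
    ∃ K : TCCircuit (VectorBits C v) (VectorBits (Fin n) (2 * v + 1)),
      K.depth ≤ 140 ∧ K.size ≤ Fintype.card (VectorBits (Fin n) (2 * v + 1)) * P ^ 550 ∧
      ∀ (ξ : VectorBits C v → Bool) (x : C → ℚ), EncodesVector ξ x →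
        EncodesVector (K.eval ξ) fun j => x (c j) - x c₀ := by
  choose f hf1 hf2 using fun j =>
    Decides.exists_fraction_sub (I := VectorBits C v) hP hv (fun t => (c j, t)) (fun t => (c₀, t))
  obtain ⟨K, h1, h2, h3⟩ := Decides.exists_circuit
    (f := fun o : VectorBits (Fin n) (2 * v + 1) => f o.1 o.2)
    fun o => hf1 o.1 o.2
  refine ⟨K, h1, h2, fun ξ x hx j => ?_⟩
  obtain ⟨e1, e2⟩ := hf2 j ξ
  obtain ⟨p1, p2⟩ := hx (c j)
  obtain ⟨q1, q2⟩ := hx c₀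
  simp only [h3]
  rw [e1, e2, p2, q2]
  refine ⟨Nat.mul_pos p1 q1, ?_⟩
  have p1' : (natOfBits (fun k => ξ (c j, .inr k)) : ℚ) ≠ 0 := by exact_mod_cast p1.ne'
  have q1' : (natOfBits (fun k => ξ (c₀, .inr k)) : ℚ) ≠ 0 := by exact_mod_cast q1.ne'
  push_cast
  rw [div_sub_div _ _ p1' q1']
  ring

/-! ### Sizes -/

theorem card_equation_le {m n w : ℕ} (hm : 1 ≤ m) :
    Fintype.card (Equation m n w) ≤ 13 * (n * m * w) + m := by
  have h : n * w ≤ m * (n * w) := Nat.le_mul_of_pos_left _ hm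
  have e : n * m * w = m * (n * w) := by ring
  simp only [Fintype.card_sum, Fintype.card_prod, Fintype.card_fin]
  rw [e]
  omega

theorem card_point_le {m n w : ℕ} (hm : 1 ≤ m) :
    Fintype.card (Point m n w) ≤ 6 * (n * m * w) + 1 := by
  have h : n * w ≤ m * (n * w) := Nat.le_mul_of_pos_left _ hm
  have e : n * m * w = m * (n * w) := by ring
  simp only [Fintype.card_option, Fintype.card_sum, Fintype.card_prod, Fintype.card_fin]
  rw [e]
  omega

theorem le_mul_pow_of_le {s k Q e f c : ℕ} (hQ : 0 < Q) (hk : k ≤ Q ^ e) (hs : s ≤ k * Q ^ f)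
    (hc : e + f + 1 ≤ c) : s ≤ c * Q ^ c :=
  calc s ≤ Q ^ e * Q ^ f := hs.trans (Nat.mul_le_mul_right _ hk)
    _ = Q ^ (e + f) := (pow_add _ _ _).symm
    _ ≤ Q ^ c := Nat.pow_le_pow_right hQ (by omega)
    _ ≤ c * Q ^ c := Nat.le_mul_of_pos_left _ (by omega)

theorem card_systemBits_le {m n w u M N Q : ℕ} (hQ : 2 ≤ Q) (hm : m ≤ Q) (hnw : n + w ≤ Q)
    (hu : u + 1 ≤ Q) (hM : M ≤ 14 * (n * m * w)) (hN : N ≤ 7 * (n * m * w)) :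
    Fintype.card (SystemBits (Fin M) (Fin N ⊕ Fin N) 1 u) ≤ Q ^ 16 := by
  have hcube : n * m * w ≤ Q ^ 3 :=
    calc n * m * w ≤ Q * Q * Q :=
          Nat.mul_le_mul (Nat.mul_le_mul (by omega) hm) (by omega)
      _ = Q ^ 3 := by ring
  have h1 : 1 ≤ Q ^ 3 := Nat.one_le_pow _ _ (by omega)
  have h2 : u + 1 ≤ Q ^ 3 * Q := hu.trans (Nat.le_mul_of_pos_left _ h1)
  have h3 : Q ^ 3 ≤ Q ^ 3 * Q := Nat.le_mul_of_pos_right _ (by omega)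
  calc Fintype.card (SystemBits (Fin M) (Fin N ⊕ Fin N) 1 u)
      = M * ((N + N) * 2 + (u + 1)) := by
        simp only [Fintype.card_sum, Fintype.card_prod, Fintype.card_fin, Fintype.card_option]
        ring
    _ ≤ (14 * Q ^ 3) * (29 * (Q ^ 3 * Q)) := Nat.mul_le_mul (by omega) (by omega)
    _ = Q ^ 7 * 406 := by ring
    _ ≤ Q ^ 7 * 2 ^ 9 := Nat.mul_le_mul_left _ (by norm_num)
    _ ≤ Q ^ 7 * Q ^ 9 := Nat.mul_le_mul_left _ (Nat.pow_le_pow_left hQ 9)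
    _ = Q ^ 16 := by ring

/-! ### Equivalence with a two-commodity system -/

theorem mainTheorem3 :
    ∃ d c : ℕ, ∀ m n w : ℕ, 1 ≤ m → 1 ≤ n → 1 ≤ w →
      ∃ M N B : ℕ,
        M ≤ c * (n * m * w * Nat.log 2 (n + 1)) ∧
        N + N ≤ c * (n * m * w * Nat.log 2 (n + 1)) ∧
        B ≤ c * (w * Nat.log 2 (n + 1)) ∧
        ∃ (V : ℕ → ℕ)
          (S : ∀ v : ℕ, TCCircuit (VectorBits (Fin N ⊕ Fin N) v) (VectorBits (Fin n) (V v))),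
          (∀ v : ℕ, (S v).depth ≤ d ∧ (S v).size ≤ c * (m + n + w + v) ^ c) ∧
          ∀ u : ℕ, ∃ (U : ℕ)
            (K : TCCircuit (SystemBits (Fin m) (Fin n) w u)
              (SystemBits (Fin M) (Fin N ⊕ Fin N) B U)),
            K.depth ≤ d ∧ K.size ≤ c * (m + n + w + u) ^ c ∧
            ∀ (A : Matrix (Fin m) (Fin n) ℤ) (b : Fin m → ℤ)
              (α : SystemBits (Fin m) (Fin n) w u → Bool), EncodesSystem α A b →
              ∃ (A₁ : Matrix (Fin M) (Fin N ⊕ Fin N) ℤ) (b₁ : Fin M → ℤ),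
                EncodesSystem (K.eval α) A₁ b₁ ∧
                IsMC2 A₁ ∧
                ((∃ x : Fin n → ℝ, SolvesOver ℝ A b x) ↔
                  ∃ x₁ : Fin N ⊕ Fin N → ℝ, SolvesOver ℝ A₁ b₁ x₁) ∧
                ∀ (v : ℕ) (x₁ : Fin N ⊕ Fin N → ℚ)
                  (ξ : VectorBits (Fin N ⊕ Fin N) v → Bool),
                  EncodesVector ξ x₁ → SolvesOver ℚ A₁ b₁ x₁ →
                  ∃ x : Fin n → ℚ, EncodesVector ((S v).eval ξ) x ∧ SolvesOver ℚ A b x := by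
  refine ⟨140, 700, fun m n w hm hn hw => ?_⟩
  have hw' : 0 < w := hw
  obtain ⟨M, hM, ⟨eR⟩⟩ : ∃ M, Fintype.card (Equation m n w) = M ∧
      Nonempty (Equation m n w ≃ Fin M) := ⟨_, rfl, ⟨Fintype.equivFin _⟩⟩
  obtain ⟨N, hN, ⟨eP⟩⟩ : ∃ N, Fintype.card (Point m n w) = N ∧
      Nonempty (Point m n w ≃ Fin N) := ⟨_, rfl, ⟨Fintype.equivFin _⟩⟩
  have hlog : 1 ≤ Nat.log 2 (n + 1) := Nat.log_pos (by omega) (by omega)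
  have hnmw : m ≤ n * m * w :=
    (Nat.le_mul_of_pos_left m hn).trans (Nat.le_mul_of_pos_right _ hw)
  have hM' : M ≤ 14 * (n * m * w) := hM.ge.trans <| (card_equation_le hm).trans (by omega)
  have hN' : N ≤ 7 * (n * m * w) := hN.ge.trans <| (card_point_le hm).trans (by omega)
  have hL : n * m * w ≤ n * m * w * Nat.log 2 (n + 1) := Nat.le_mul_of_pos_right _ hlog
  have hWL : w ≤ w * Nat.log 2 (n + 1) := Nat.le_mul_of_pos_right _ hlog
  have hdiff := fun v => exists_difference_circuit (C := Fin N ⊕ Fin N) (n := n)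
    (P := m + n + w + v) (v := v) (by omega) (by omega)
    (fun j => .inl (eP (Point.right (j, ⟨0, hw'⟩)))) (.inl (eP Point.origin))
  choose S hS1 hS2 hS3 using hdiff
  refine ⟨M, N, 1, by omega, by omega, by omega, fun v => 2 * v + 1, S,
    fun v => ⟨hS1 v, ?_⟩, fun u => ?_⟩
  · refine le_mul_pow_of_le (e := 50) (by omega) ?_ (hS2 v) (by norm_num)
    set Q := m + n + w + v with hQ
    calc Fintype.card (VectorBits (Fin n) (2 * v + 1)) = n * (2 * v + 1 + 1 + (2 * v + 1)) := by
          simp only [Fintype.card_sum, Fintype.card_prod, Fintype.card_fin, Fintype.card_option]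
      _ ≤ Q * (4 * Q) := Nat.mul_le_mul (by omega) (by omega)
      _ = Q ^ 2 * 2 ^ 2 := by ring
      _ ≤ Q ^ 2 * Q ^ 2 := Nat.mul_le_mul_left _ (Nat.pow_le_pow_left (by omega) 2)
      _ = Q ^ 4 := by ring
      _ ≤ Q ^ 50 := Nat.pow_le_pow_right (by omega) (by omega)
  obtain ⟨K, hK1, hK2, hK3⟩ := Equation.exists_system_circuit eR eP
    (P := m + n + w + u) (by omega) u
  refine ⟨u, K, hK1.trans (by omega), ?_, fun A b α hα => ⟨_, _, hK3 A b α hα,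
    Equation.isMC2_matrix eR eP hn hw _, ⟨?_, ?_⟩, ?_⟩⟩
  · exact le_mul_pow_of_le (by omega) (card_systemBits_le (by omega) (by omega) (by omega)
      (by omega) hM' hN') hK2 (by norm_num)
  · rintro ⟨x, hx⟩
    rw [solvesOver_iff] at hx
    let a : Fin m → Fin n → Option (Fin w) → Bool := fun i j k => α (.inl (i, j, k))
    refine ⟨Sum.elim (fun p => Equation.fstCoord a x (eP.symm p))
      (fun p => Equation.sndCoord a x (eP.symm p)), ?_⟩
    rw [Equation.solvesOver_matrix_iff]
    simp only [Sum.elim_inl, Sum.elim_inr, Equiv.symm_apply_apply]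
    refine Equation.realizes_coord a x fun i => ?_
    simpa only [a, hα.1] using hx i
  · rintro ⟨z, hz⟩
    rw [Equation.solvesOver_matrix_iff] at hz
    refine ⟨fun j => z (.inl (eP (Point.right (j, ⟨0, hw'⟩)))) - z (.inl (eP Point.origin)),
      solvesOver_iff.mpr fun i => ?_⟩
    simpa only [hα.1] using hz.sum_eq hw' i
  · intro v z ξ hξ hz
    rw [Equation.solvesOver_matrix_iff] at hz
    refine ⟨_, hS3 v ξ z hξ, solvesOver_iff.mpr fun i => ?_⟩
    simpa only [hα.1] using hz.sum_eq hw' i
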